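/- Let $A,B$ be finite-dimensional quantum systems. For a finite-dimensional operator $Y$ put $|Y|=\sqrt{Y^\dagger Y}$, $\|Y\|_\alpha=(\operatorname{Tr}|Y|^\alpha)^{1/\alpha}$ for $1\le\alpha<\infty$, and let $\|Y\|_\infty$ be the operator norm. Let $T_B(Y_{AB})=\sum_{i,j}(I_A\otimes|i\rangle\langle j|_B)\,Y_{AB}\,(I_A\otimes|i\rangle\langle j|_B)$ be the partial transpose with respect to a fixed orthonormal basis $\{|i\rangle_B\}_i$ of $B$. For $\alpha\in[1,\infty]$, a Hermitian operator $X\neq0$ and a positive semi-definite operator $\sigma\ne 0$ set $$\mu_\alpha(X\Vert\sigma)=\begin{cases}\big\|\sigma^{\frac{1-\alpha}{2\alpha}}X\sigma^{\frac{1-\alpha}{2\alpha}}\big\|_\alpha&\text{if }\operatorname{supp}(X)\subseteq\operatorname{supp}(\sigma),\\+\infty&\text{otherwise,}\end{cases}\qquad \nu_\alpha(X\Vert\sigma)=\log_2\mu_\alpha(X\Vert\sigma),$$ where powers of $\sigma$ are taken on the support of $\sigma$ and the exponent $\frac{1-\alpha}{2\alpha}$ is read as $-\frac12$ for $\alpha=\infty$.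 Let $\operatorname{PPT}(A:B)=\{\sigma_{AB}:\sigma_{AB}\ge0,\ T_B(\sigma_{AB})\ge0,\ \operatorname{Tr}[\sigma_{AB}]=1\}$. For a bipartite state $\rho_{AB}$ (that is, $\rho_{AB}\ge0$ and $\operatorname{Tr}[\rho_{AB}]=1$), define the logarithmic negativity and the $\alpha$-logarithmic negativity by $$E_N(\rho_{AB})=\log_2\|T_B(\rho_{AB})\|_1,\qquad E_N^\alpha(\rho_{AB})=\inf_{\sigma_{AB}\in\operatorname{PPT}(A:B)}\nu_\alpha(T_B(\rho_{AB})\Vert\sigma_{AB}).$$ \textbf{Proposition} (ordering). Let $\rho_{AB}$ be a bipartite quantum state and let $1\le\alpha\le\beta\le\infty$. Then $$E_N(\rho_{AB})\le E_N^\alpha(\rho_{AB})\le E_N^\beta(\rho_{AB}).$$ -/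

import Mathlib

open scoped ENNReal NNReal Matrix MatrixOrder ComplexOrder

namespace LogNeg

noncomputable section

variable {a b n : Type*} [Fintype a] [DecidableEq a] [Fintype b] [DecidableEq b]
  [Fintype n] [DecidableEq n]

/-- Quantum states (density operators) on the finite-dimensional Hilbert space `ℂⁿ`, as matrices:
positive semi-definite with unit trace. -/
def IsState (ρ : Matrix n n ℂ) : Prop := ρ.PosSemidef ∧ ρ.trace = 1

/-- The partial transpose
`T_B(Y) = ∑_{i,j} (I_A ⊗ |i⟩⟨j|_B) Y (I_A ⊗ |i⟩⟨j|_B)`, for the standard basis of `B`. -/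
def partialTranspose (Y : Matrix (a × b) (a × b) ℂ) : Matrix (a × b) (a × b) ℂ :=
  ∑ i : b, ∑ j : b,
    Matrix.kronecker (1 : Matrix a a ℂ) (Matrix.single i j (1 : ℂ)) * Y *
      Matrix.kronecker (1 : Matrix a a ℂ) (Matrix.single i j (1 : ℂ))

/-- The partial transpose acts on entries by exchanging the two `B`-indices. -/
theorem partialTranspose_apply (Y : Matrix (a × b) (a × b) ℂ) (p q : a × b) :
    partialTranspose Y p q = Y (p.1, q.2) (q.1, p.2) := by
  obtain ⟨p1, p2⟩ := p
  obtain ⟨q1, q2⟩ := q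
  simp [partialTranspose, Matrix.sum_apply, Matrix.mul_apply, Fintype.sum_prod_type,
    Matrix.one_apply, Matrix.single_apply, ite_and, Finset.sum_ite_eq, Finset.sum_ite_eq']

/-- The trace norm `‖X‖₁ = Tr √(X†X)`; here `CFC.abs X` is `√(X†X)`. -/
def traceNorm (X : Matrix n n ℂ) : ℝ := (CFC.abs X).trace.re

/-- The `α`-norm `‖Y‖_α = (Tr |Y|^α)^{1/α}` for `1 ≤ α < ∞`, and the operator norm for `α = ∞`. -/
def alphaNorm (α : ℝ≥0∞) (Y : Matrix n n ℂ) : ℝ :=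
  if α = ∞ then ‖Matrix.toEuclideanCLM (n := n) (𝕜 := ℂ) Y‖
  else ((CFC.abs Y ^ α.toReal).trace.re) ^ (1 / α.toReal)

/-- The support of an operator: the orthogonal complement of its kernel. -/
def supp (X : Matrix n n ℂ) : Submodule ℂ (EuclideanSpace ℂ n) :=
  (LinearMap.ker (Matrix.toEuclideanLin X))ᗮ

/-- The power `σ^s` of a positive semi-definite operator in the generalized sense, i.e. taken on
the support of `σ`: the eigenvalues `x ≠ 0` become `x ^ s`, and the kernel of `σ` is sent to `0`. -/
def suppPow (σ : Matrix n n ℂ) (s : ℝ) : Matrix n n ℂ :=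
  cfc (fun x : ℝ => if x = 0 then 0 else x ^ s) σ

/-- The exponent `(1 - α) / (2 α)`, with its limiting value `-1/2` at `α = ∞`. -/
def expo (α : ℝ≥0∞) : ℝ :=
  if α = ∞ then -1 / 2 else (1 - α.toReal) / (2 * α.toReal)

open Classical in
/-- `μ_α(X‖σ) = ‖σ^{(1-α)/2α} X σ^{(1-α)/2α}‖_α` if `supp X ⊆ supp σ`, and `+∞` otherwise.
For `α = ∞` this is `‖σ^{-1/2} X σ^{-1/2}‖_∞`. -/
def mu (α : ℝ≥0∞) (X σ : Matrix n n ℂ) : ℝ≥0∞ :=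
  if supp X ≤ supp σ then
    ENNReal.ofReal (alphaNorm α (suppPow σ (expo α) * X * suppPow σ (expo α)))
  else ∞

/-- `ν_α(X‖σ) = log₂ μ_α(X‖σ)`, with `log₂ ∞ = ∞`. -/
def nu (α : ℝ≥0∞) (X σ : Matrix n n ℂ) : EReal :=
  ENNReal.log (mu α X σ) / (Real.log 2 : EReal)

/-- The set `PPT(A:B)` of states with positive partial transpose. -/
def PPT (a b : Type*) [Fintype a] [DecidableEq a] [Fintype b] [DecidableEq b] :
    Set (Matrix (a × b) (a × b) ℂ) :=
  {σ | σ.PosSemidef ∧ (partialTranspose σ).PosSemidef ∧ σ.trace = 1}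

/-- The logarithmic negativity `E_N(ρ) = log₂ ‖T_B(ρ)‖₁`. -/
def logNeg (ρ : Matrix (a × b) (a × b) ℂ) : ℝ :=
  Real.logb 2 (traceNorm (partialTranspose ρ))

/-- The `α`-logarithmic negativity `E_N^α(ρ) = inf_{σ ∈ PPT(A:B)} ν_α(T_B(ρ)‖σ)`. -/
def alphaLogNeg (α : ℝ≥0∞) (ρ : Matrix (a × b) (a × b) ℂ) : EReal :=
  ⨅ σ ∈ PPT a b, nu α (partialTranspose ρ) σ

end

end LogNeg

/-! Both inequalities follow from monotonicity of `mu` in `α` for a fixed state `σ`, since `mu 1 X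
σ` is the trace norm of `X` once the supports are compatible. With `t = 1/α - 1/β` and `Y = σ^(expo
β) X σ^(expo β)`, the operator inside `mu α` is `σ^(t/2) Y σ^(t/2)`, so a Hölder inequality is
needed: `alphaNorm_conj_suppPow_le`.

It is reduced to scalars. In eigenbases of `Y` and of the conjugated operator, the eigenvalues of
the latter are dominated by those of `Y` through the matrix `‖N j k‖²`, `N = Vᴴ σ^(t/2) W`. By
Jensen its row and column sums are at most `t`-th powers of the diagonals of `σ` in the two bases,
which are probability vectors. `sum_rpow_le_of_row_col_sums` then concludes, in the manner of a
Schur test. -/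

open scoped ENNReal NNReal Matrix MatrixOrder ComplexOrder

namespace LogNeg

open Finset

/-! ### Scalar Hölder and Schur-type estimates -/

section Scalar

variable {ι κ : Type*} [Fintype ι] [Fintype κ]

/-- Hölder's inequality for weights `a + b = 1`, including the degenerate weights `0` and `1`. -/
theorem sum_rpow_mul_rpow_le (f g : ι → ℝ) (hf : ∀ i, 0 ≤ f i) (hg : ∀ i, 0 ≤ g i)
    {a b : ℝ} (ha : 0 ≤ a) (hb : 0 ≤ b) (hab : a + b = 1) :
    ∑ i, f i ^ a * g i ^ b ≤ (∑ i, f i) ^ a * (∑ i, g i) ^ b := by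
  rcases ha.eq_or_lt with rfl | ha
  · obtain rfl : b = 1 := by linarith
    simp
  rcases hb.eq_or_lt with rfl | hb
  · obtain rfl : a = 1 := by linarith
    simp
  have hpq : (1 / a).HolderConjugate (1 / b) := by
    rw [Real.holderConjugate_iff]
    refine ⟨?_, by simpa using hab⟩
    rw [lt_div_iff₀ ha]; linarith
  have h := Real.inner_le_Lp_mul_Lq univ (fun i => f i ^ a) (fun i => g i ^ b) hpq
  have e : ∀ (x c : ℝ), 0 ≤ x → 0 < c → |x ^ c| ^ (1 / c) = x := fun x c hx hc => by
    rw [abs_of_nonneg (Real.rpow_nonneg hx c), ← Real.rpow_mul hx, mul_one_div_cancel hc.ne',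
      Real.rpow_one]
  simpa [e _ _ (hf _) ha, e _ _ (hg _) hb, -one_div, one_div_one_div] using h

/-- A matrix with nonnegative entries whose row and column sums are bounded by `u ^ t` and `v ^ t`
for probability vectors `u`, `v` is a contraction from `ℓ^(1/a)` to `ℓ^(1/(a+t))`. -/
theorem sum_rpow_le_of_row_col_sums (M : ι → κ → ℝ) (hM : ∀ j k, 0 ≤ M j k)
    (y : ι → ℝ) (hy : ∀ j, 0 ≤ y j) (u : ι → ℝ) (hu : ∀ j, 0 ≤ u j) (hu1 : ∑ j, u j = 1)
    (v : κ → ℝ) (hv : ∀ k, 0 ≤ v k) (hv1 : ∑ k, v k = 1)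
    {a t : ℝ} (ha : 0 < a) (ht : 0 ≤ t) (hat : a + t ≤ 1)
    (hrow : ∀ j, ∑ k, M j k ≤ u j ^ t) (hcol : ∀ k, ∑ j, M j k ≤ v k ^ t) :
    ∑ k, (∑ j, M j k * y j) ^ (1 / (a + t)) ≤ (∑ j, y j ^ (1 / a)) ^ (a / (a + t)) := by
  have ht1 : 0 < 1 - t := by linarith
  have hs : 0 < a + t := by linarith
  -- This `w` solves `t + w * (1 - t) = a + t`, which makes the two exponents in `hexp` sum to `1`.
  set w := a / (1 - t) with hw
  set p := (1 - t) / a with hp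
  have hw0 : 0 < w := by positivity
  have hw1 : w ≤ 1 := by rw [hw, div_le_one ht1]; linarith
  have hpw : p * w = 1 := by rw [hp, hw]; field_simp
  have hWn : ∀ k, 0 ≤ ∑ j, M j k * y j ^ p := fun k =>
    sum_nonneg fun j _ => mul_nonneg (hM j k) (Real.rpow_nonneg (hy j) _)
  have step1 : ∀ k, (∑ j, M j k * y j) ≤ (v k ^ t) ^ (1 - w) * (∑ j, M j k * y j ^ p) ^ w := by
    intro k
    have h := sum_rpow_mul_rpow_le (fun j => M j k) (fun j => M j k * y j ^ p)
      (fun j => hM j k) (fun j => mul_nonneg (hM j k) (Real.rpow_nonneg (hy j) _))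
      (a := 1 - w) (b := w) (by linarith) hw0.le (by ring)
    have e : ∀ j, M j k ^ (1 - w) * (M j k * y j ^ p) ^ w = M j k * y j := fun j => by
      rw [Real.mul_rpow (hM j k) (Real.rpow_nonneg (hy j) _), ← Real.rpow_mul (hy j), hpw,
        Real.rpow_one, ← mul_assoc, ← Real.rpow_add' (hM j k) (by simp)]
      simp
    simp only [e] at h
    refine h.trans (mul_le_mul_of_nonneg_right ?_ (Real.rpow_nonneg (hWn k) _))
    exact Real.rpow_le_rpow (sum_nonneg fun j _ => hM j k) (hcol k) (by linarith)
  have hexp : t * (1 - w) * (1 / (a + t)) + w * (1 / (a + t)) = 1 := by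
    rw [hw]; field_simp; ring
  have step2 : ∀ k, (∑ j, M j k * y j) ^ (1 / (a + t)) ≤
      v k ^ (t * (1 - w) * (1 / (a + t))) * (∑ j, M j k * y j ^ p) ^ (w * (1 / (a + t))) := by
    intro k
    refine (Real.rpow_le_rpow (sum_nonneg fun j _ => mul_nonneg (hM j k) (hy j)) (step1 k)
      (by positivity)).trans_eq ?_
    rw [Real.mul_rpow (by have := hv k; positivity) (Real.rpow_nonneg (hWn k) _),
      ← Real.rpow_mul (hv k), ← Real.rpow_mul (hv k), ← Real.rpow_mul (hWn k)]
  have hw1' : 0 ≤ 1 - w := by linarith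
  have step3 : ∑ k, (∑ j, M j k * y j) ^ (1 / (a + t)) ≤
      (∑ k, ∑ j, M j k * y j ^ p) ^ (w * (1 / (a + t))) := by
    refine (sum_le_sum fun k _ => step2 k).trans ?_
    refine (sum_rpow_mul_rpow_le v (fun k => ∑ j, M j k * y j ^ p) hv hWn
      (by positivity) (by positivity) hexp).trans_eq ?_
    rw [hv1, Real.one_rpow, one_mul]
  have hYn : 0 ≤ ∑ j, y j ^ (1 / a) := sum_nonneg fun j _ => Real.rpow_nonneg (hy j) _
  have step4 : ∑ k, ∑ j, M j k * y j ^ p ≤ (∑ j, y j ^ (1 / a)) ^ (1 - t) := by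
    rw [sum_comm]
    have h := sum_rpow_mul_rpow_le u (fun j => y j ^ (1 / a)) hu
      (fun j => Real.rpow_nonneg (hy j) _) ht ht1.le (by ring)
    rw [hu1, Real.one_rpow, one_mul] at h
    refine le_trans (sum_le_sum fun j _ => ?_) h
    rw [← sum_mul, ← Real.rpow_mul (hy j), show 1 / a * (1 - t) = p by rw [hp]; ring]
    exact mul_le_mul_of_nonneg_right (hrow j) (Real.rpow_nonneg (hy j) _)
  refine step3.trans ((Real.rpow_le_rpow (sum_nonneg fun k _ => hWn k) step4
    (by positivity)).trans_eq ?_)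
  rw [← Real.rpow_mul hYn]
  congr 1
  rw [hw]; field_simp

end Scalar

/-! ### Spectral calculus for Hermitian matrices -/

section Spectral

variable {n : Type*} [Fintype n] [DecidableEq n]

open Matrix

theorem cfc_eq_mul_diagonal_mul {A : Matrix n n ℂ} (hA : A.IsHermitian) (f : ℝ → ℝ) :
    cfc f A = (hA.eigenvectorUnitary : Matrix n n ℂ) *
      diagonal (fun i => (f (hA.eigenvalues i) : ℂ)) *
        (hA.eigenvectorUnitary : Matrix n n ℂ)ᴴ := by
  rw [hA.cfc_eq, IsHermitian.cfc, Unitary.conjStarAlgAut_apply]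
  rfl

theorem continuousOn_real_spectrum (A : Matrix n n ℂ) (f : ℝ → ℝ) :
    ContinuousOn f (spectrum ℝ A) :=
  (Matrix.finite_real_spectrum (A := A)).continuousOn f

theorem eigenvectorUnitary_conjTranspose_mul {A : Matrix n n ℂ} (hA : A.IsHermitian) :
    (hA.eigenvectorUnitary : Matrix n n ℂ)ᴴ * (hA.eigenvectorUnitary : Matrix n n ℂ) = 1 :=
  Unitary.coe_star_mul_self hA.eigenvectorUnitary

theorem eigenvectorUnitary_mul_conjTranspose {A : Matrix n n ℂ} (hA : A.IsHermitian) :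
    (hA.eigenvectorUnitary : Matrix n n ℂ) * (hA.eigenvectorUnitary : Matrix n n ℂ)ᴴ = 1 :=
  Unitary.coe_mul_star_self hA.eigenvectorUnitary

theorem cfc_real_id {A : Matrix n n ℂ} (hA : A.IsHermitian) : cfc (fun x : ℝ => x) A = A :=
  cfc_id' ℝ A hA.isSelfAdjoint

theorem eq_mul_diagonal_mul {A : Matrix n n ℂ} (hA : A.IsHermitian) :
    A = (hA.eigenvectorUnitary : Matrix n n ℂ) *
      diagonal (fun i => (hA.eigenvalues i : ℂ)) *
        (hA.eigenvectorUnitary : Matrix n n ℂ)ᴴ := by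
  have h := cfc_eq_mul_diagonal_mul hA (fun x => x)
  rwa [cfc_real_id hA] at h

theorem trace_cfc {A : Matrix n n ℂ} (hA : A.IsHermitian) (f : ℝ → ℝ) :
    (cfc f A).trace.re = ∑ i, f (hA.eigenvalues i) := by
  rw [cfc_eq_mul_diagonal_mul hA, trace_mul_comm, ← mul_assoc,
    eigenvectorUnitary_conjTranspose_mul, one_mul, trace_diagonal]
  simp

theorem abs_eq_cfc_abs {A : Matrix n n ℂ} (hA : A.IsHermitian) :
    CFC.abs A = cfc (fun x : ℝ => |x|) A :=
  CFC.abs_eq_cfc_norm A hA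

theorem abs_rpow_eq_cfc {A : Matrix n n ℂ} (hA : A.IsHermitian) (r : ℝ) :
    CFC.abs A ^ r = cfc (fun x : ℝ => |x| ^ r) A := by
  rw [CFC.rpow_eq_cfc_real (CFC.abs_nonneg A), abs_eq_cfc_abs hA]
  exact (cfc_comp' (fun x : ℝ => x ^ r) (fun x : ℝ => |x|) A
    ((Set.Finite.image _ (Matrix.finite_real_spectrum (A := A))).continuousOn _)
    (continuousOn_real_spectrum A _) hA).symm

theorem traceNorm_eq_sum {A : Matrix n n ℂ} (hA : A.IsHermitian) :
    traceNorm A = ∑ i, |hA.eigenvalues i| := by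
  rw [traceNorm, abs_eq_cfc_abs hA, trace_cfc hA]

theorem alphaNorm_eq_sum {A : Matrix n n ℂ} (hA : A.IsHermitian) {α : ℝ≥0∞} (h : α ≠ ∞) :
    alphaNorm α A = (∑ i, |hA.eigenvalues i| ^ α.toReal) ^ (1 / α.toReal) := by
  rw [alphaNorm, if_neg h, abs_rpow_eq_cfc hA, trace_cfc hA]

theorem abs_eigenvalues_le_alphaNorm_top {A : Matrix n n ℂ} (hA : A.IsHermitian) (i : n) :
    |hA.eigenvalues i| ≤ alphaNorm ∞ A := by
  rw [alphaNorm, if_pos rfl]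
  have h := (Matrix.toEuclideanCLM (n := n) (𝕜 := ℂ) A).le_opNorm (hA.eigenvectorBasis i)
  have e : Matrix.toEuclideanCLM (n := n) (𝕜 := ℂ) A (hA.eigenvectorBasis i) =
      (hA.eigenvalues i : ℂ) • hA.eigenvectorBasis i := by
    apply (WithLp.ofLp_injective 2)
    rw [Matrix.ofLp_toEuclideanCLM, hA.mulVec_eigenvectorBasis]
    ext; simp
  rw [e, norm_smul, hA.eigenvectorBasis.norm_eq_one] at h
  simpa using h

theorem isHermitian_suppPow (σ : Matrix n n ℂ) (s : ℝ) : (suppPow σ s).IsHermitian :=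
  cfc_predicate _ σ

/-- Sending the eigenvalue `0` to `0` keeps the exponent law valid for negative exponents and for `s
+ s' = 0`, where the product is the support projection. -/
theorem suppPow_mul_suppPow {σ : Matrix n n ℂ} (hσ : σ.PosSemidef) (s s' : ℝ) :
    suppPow σ s * suppPow σ s' = suppPow σ (s + s') := by
  rw [suppPow, suppPow, suppPow, ← cfc_mul _ _ σ (continuousOn_real_spectrum σ _)
    (continuousOn_real_spectrum σ _)]
  refine cfc_congr fun x hx => ?_
  have hx0 : 0 ≤ x := by
    rw [hσ.1.spectrum_real_eq_range_eigenvalues] at hx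
    obtain ⟨i, rfl⟩ := hx
    exact hσ.eigenvalues_nonneg i
  rcases hx0.eq_or_lt with rfl | hx0
  · simp
  · simp [hx0.ne', Real.rpow_add hx0]

/-- `suppPow σ 0` is the projection onto the support of `σ`; the columns of its complement lie in
`ker σ`, hence in `ker X`. -/
theorem mul_suppPow_zero_of_ker_le {σ X : Matrix n n ℂ} (hσ : σ.IsHermitian)
    (h : supp X ≤ supp σ) : X * suppPow σ 0 = X := by
  have hker : LinearMap.ker (toEuclideanLin σ) ≤ LinearMap.ker (toEuclideanLin X) := by
    have := Submodule.orthogonal_le h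
    rwa [supp, supp, Submodule.orthogonal_orthogonal, Submodule.orthogonal_orthogonal] at this
  have h0 : σ * (1 - suppPow σ 0) = 0 := by
    have h1 : σ * suppPow σ 0 = σ := by
      conv_lhs => enter [1]; rw [← cfc_real_id hσ]
      rw [suppPow, ← cfc_mul _ _ σ (continuousOn_real_spectrum σ _)
        (continuousOn_real_spectrum σ _)]
      conv_rhs => rw [← cfc_real_id hσ]
      refine cfc_congr fun x _ => ?_
      by_cases hx : x = 0 <;> simp [hx]
    rw [mul_sub, mul_one, h1, sub_self]
  have hX : X * (1 - suppPow σ 0) = 0 := by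
    ext i j
    have hm : WithLp.toLp 2 ((1 - suppPow σ 0).col j) ∈ LinearMap.ker (toEuclideanLin σ) := by
      rw [LinearMap.mem_ker]
      ext k
      exact congrFun (congrFun h0 k) j
    have := LinearMap.mem_ker.1 (hker hm)
    exact congrArg (fun v : EuclideanSpace ℂ n => v i) this
  rw [mul_sub, mul_one, sub_eq_zero] at hX
  exact hX.symm

theorem suppPow_zero_mul_mul {σ X : Matrix n n ℂ} (hσ : σ.IsHermitian) (hX : X.IsHermitian)
    (h : supp X ≤ supp σ) : suppPow σ 0 * X * suppPow σ 0 = X := by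
  have h1 := mul_suppPow_zero_of_ker_le hσ h
  have h2 := congrArg conjTranspose h1
  rw [conjTranspose_mul, (isHermitian_suppPow σ 0).eq, hX.eq] at h2
  rw [h2, h1]

/-! ### Squared overlaps between eigenbases -/

theorem conj_diagonal_apply_re (N : Matrix n n ℂ) (d : n → ℝ) (j : n) :
    ((Nᴴ * diagonal (fun i => (d i : ℂ)) * N) j j).re = ∑ i, ‖N i j‖ ^ 2 * d i := by
  rw [Matrix.mul_apply, Complex.re_sum]
  refine sum_congr rfl fun i _ => ?_
  rw [Matrix.mul_diagonal, conjTranspose_apply, mul_right_comm, RCLike.star_def,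
    Complex.conj_mul', ← Complex.ofReal_pow, ← Complex.ofReal_mul, Complex.ofReal_re]

theorem sum_norm_sq_col {N : Matrix n n ℂ} (hN : Nᴴ * N = 1) (j : n) :
    ∑ i, ‖N i j‖ ^ 2 = 1 := by
  have h := conj_diagonal_apply_re N (fun _ => 1) j
  simp only [Complex.ofReal_one, diagonal_one, mul_one, hN, one_apply_eq, Complex.one_re] at h
  exact h.symm

theorem conj_cfc_apply_re {σ V : Matrix n n ℂ} (hσ : σ.IsHermitian) (f : ℝ → ℝ) (j : n) :
    ((Vᴴ * cfc f σ * V) j j).re =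
      ∑ i, ‖((hσ.eigenvectorUnitary : Matrix n n ℂ)ᴴ * V) i j‖ ^ 2 * f (hσ.eigenvalues i) := by
  rw [← conj_diagonal_apply_re _ (fun i => f (hσ.eigenvalues i)), cfc_eq_mul_diagonal_mul hσ]
  simp [conjTranspose_mul, mul_assoc]

/-- Jensen's inequality `⟨f, σ^t f⟩ ≤ ⟨f, σ f⟩^t` for unit vectors `f` and `0 < t ≤ 1`. -/
theorem conj_suppPow_apply_re_le {σ V : Matrix n n ℂ} (hσ : σ.PosSemidef) (hV : Vᴴ * V = 1)
    {t : ℝ} (ht : 0 < t) (ht1 : t ≤ 1) (j : n) :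
    ((Vᴴ * suppPow σ t * V) j j).re ≤ ((Vᴴ * σ * V) j j).re ^ t := by
  have e := conj_cfc_apply_re (V := V) hσ.1 (fun x => x) j
  rw [cfc_real_id hσ.1] at e
  rw [e, suppPow, conj_cfc_apply_re hσ.1]
  set q := fun i => ‖((hσ.1.eigenvectorUnitary : Matrix n n ℂ)ᴴ * V) i j‖ ^ 2 with hq
  have hq0 : ∀ i, 0 ≤ q i := fun i => by positivity
  have hq1 : ∑ i, q i = 1 := sum_norm_sq_col (by
    rw [conjTranspose_mul, conjTranspose_conjTranspose, mul_assoc,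
      ← mul_assoc _ _ V, eigenvectorUnitary_mul_conjTranspose, one_mul, hV]) j
  have hp := hσ.eigenvalues_nonneg
  have h := sum_rpow_mul_rpow_le q (fun i => q i * hσ.1.eigenvalues i) hq0
    (fun i => mul_nonneg (hq0 i) (hp i)) (a := 1 - t) (b := t) (by linarith) ht.le (by ring)
  rw [hq1, Real.one_rpow, one_mul] at h
  refine (sum_le_sum fun i _ => le_of_eq ?_).trans h
  rw [Real.mul_rpow (hq0 i) (hp i), ← mul_assoc, ← Real.rpow_add' (hq0 i) (by simp)]
  -- At eigenvalue `0` the convention of `suppPow` agrees with `0 ^ t = 0` because `t > 0`.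
  by_cases h0 : hσ.1.eigenvalues i = 0
  · simp [h0, Real.zero_rpow ht.ne']
  · simp [h0, hq]

/-- The row sum is a diagonal entry of `N Nᴴ`, from which `W` cancels, leaving `Vᴴ σ^t V`; Jensen
applies. Exchanging `V` and `W` bounds the column sums. -/
theorem sum_norm_sq_row_le {σ V W : Matrix n n ℂ} (hσ : σ.PosSemidef) (hV : Vᴴ * V = 1)
    (hW : W * Wᴴ = 1) {t : ℝ} (ht : 0 < t) (ht1 : t ≤ 1) (j : n) :
    ∑ k, ‖(Vᴴ * suppPow σ (t / 2) * W) j k‖ ^ 2 ≤ ((Vᴴ * σ * V) j j).re ^ t := by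
  refine le_trans (le_of_eq ?_) (conj_suppPow_apply_re_le hσ hV ht ht1 j)
  have h := conj_diagonal_apply_re (Vᴴ * suppPow σ (t / 2) * W)ᴴ (fun _ => 1) j
  simp only [Complex.ofReal_one, diagonal_one, mul_one, conjTranspose_apply, norm_star] at h
  rw [← h, conjTranspose_conjTranspose, conjTranspose_mul, conjTranspose_mul,
    conjTranspose_conjTranspose, (isHermitian_suppPow σ _).eq]
  rw [show Vᴴ * suppPow σ (t / 2) * W * (Wᴴ * (suppPow σ (t / 2) * V)) =
    Vᴴ * suppPow σ (t / 2) * (W * Wᴴ) * suppPow σ (t / 2) * V by simp only [mul_assoc], hW,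
    mul_one, mul_assoc Vᴴ, suppPow_mul_suppPow hσ, add_halves]

theorem sum_conj_apply_re {σ V : Matrix n n ℂ} (h1 : σ.trace = 1) (hV : V * Vᴴ = 1) :
    ∑ j, ((Vᴴ * σ * V) j j).re = 1 := by
  have : (Vᴴ * σ * V).trace = 1 := by rw [mul_assoc, trace_mul_comm, mul_assoc, hV, mul_one, h1]
  rw [← Complex.re_sum]
  exact congrArg Complex.re this

theorem conj_apply_re_nonneg {n : Type*} [Fintype n] {σ : Matrix n n ℂ} (hσ : σ.PosSemidef)
    (V : Matrix n n ℂ) (j : n) :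
    0 ≤ ((Vᴴ * σ * V) j j).re :=
  (Complex.nonneg_iff.1 ((hσ.conjTranspose_mul_mul_same V).diag_nonneg (i := j))).1

/-- The eigenvalues of `S Y S`, for Hermitian `S`, in terms of those of `Y`. -/
theorem abs_eigenvalues_conj_le {S Y : Matrix n n ℂ} (hS : S.IsHermitian) (hY : Y.IsHermitian)
    (hZ : (S * Y * S).IsHermitian) (k : n) :
    |hZ.eigenvalues k| ≤
      ∑ j, ‖((hY.eigenvectorUnitary : Matrix n n ℂ)ᴴ * S * (hZ.eigenvectorUnitary : Matrix n n ℂ))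
        j k‖ ^ 2 * |hY.eigenvalues j| := by
  set V := (hY.eigenvectorUnitary : Matrix n n ℂ) with hVdef
  set W := (hZ.eigenvectorUnitary : Matrix n n ℂ) with hWdef
  have hdiag : Wᴴ * (S * Y * S) * W = diagonal (fun i => (hZ.eigenvalues i : ℂ)) := by
    conv_lhs => rw [eq_mul_diagonal_mul hZ]
    rw [← hWdef, ← mul_assoc, ← mul_assoc, eigenvectorUnitary_conjTranspose_mul hZ, one_mul,
      mul_assoc, eigenvectorUnitary_conjTranspose_mul hZ, mul_one]
  have hk : hZ.eigenvalues k = ∑ j, ‖(Vᴴ * S * W) j k‖ ^ 2 * hY.eigenvalues j := by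
    rw [← conj_diagonal_apply_re]
    have : (Vᴴ * S * W)ᴴ * diagonal (fun i => (hY.eigenvalues i : ℂ)) * (Vᴴ * S * W) =
        Wᴴ * (S * Y * S) * W := by
      conv_rhs => rw [eq_mul_diagonal_mul hY]
      simp only [conjTranspose_mul, conjTranspose_conjTranspose, hS.eq, mul_assoc, ← hVdef]
    rw [this, hdiag, diagonal_apply_eq, Complex.ofReal_re]
  rw [hk]
  refine (abs_sum_le_sum_abs _ _).trans_eq (sum_congr rfl fun j _ => ?_)
  rw [abs_mul, abs_of_nonneg (by positivity)]

/-- Hölder's inequality `‖σ^{t/2} Y σ^{t/2}‖_α ≤ ‖Y‖_β` for a state `σ`, `t = 1/α - 1/β`. -/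
theorem alphaNorm_conj_suppPow_le {σ Y : Matrix n n ℂ} (hσ : σ.PosSemidef) (hσ1 : σ.trace = 1)
    (hY : Y.IsHermitian) {α β : ℝ≥0∞} (hα : 1 ≤ α) (hαβ : α < β) {t : ℝ}
    (ht : t = 1 / α.toReal - 1 / β.toReal) :
    alphaNorm α (suppPow σ (t / 2) * Y * suppPow σ (t / 2)) ≤ alphaNorm β Y := by
  have hS := isHermitian_suppPow σ (t / 2)
  have hZ : (suppPow σ (t / 2) * Y * suppPow σ (t / 2)).IsHermitian := by
    rw [IsHermitian, conjTranspose_mul, conjTranspose_mul, hS.eq, hY.eq, mul_assoc]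
  have hαt : α ≠ ∞ := hαβ.ne_top
  have hα1 : 1 ≤ α.toReal := by
    simpa using (ENNReal.toReal_le_toReal ENNReal.one_ne_top hαt).2 hα
  have hα0 : 0 < α.toReal := by linarith
  have hinv1 : 1 / α.toReal ≤ 1 := by rw [div_le_one hα0]; exact hα1
  have htpos : 0 < t := by
    rw [ht]
    by_cases hβ : β = ∞
    · simp [hβ, hα0]
    · have := (ENNReal.toReal_lt_toReal hαt hβ).2 hαβ
      exact sub_pos.2 (one_div_lt_one_div_of_lt hα0 this)
  have ht1 : t ≤ 1 := by
    have : 0 ≤ 1 / β.toReal := by positivity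
    linarith
  set V := (hY.eigenvectorUnitary : Matrix n n ℂ)
  set W := (hZ.eigenvectorUnitary : Matrix n n ℂ)
  set N := Vᴴ * suppPow σ (t / 2) * W with hN
  have hV := eigenvectorUnitary_conjTranspose_mul hY
  have hV' := eigenvectorUnitary_mul_conjTranspose hY
  have hW := eigenvectorUnitary_conjTranspose_mul hZ
  have hW' := eigenvectorUnitary_mul_conjTranspose hZ
  have hrow : ∀ j, ∑ k, ‖N j k‖ ^ 2 ≤ ((Vᴴ * σ * V) j j).re ^ t :=
    sum_norm_sq_row_le hσ hV hW' htpos ht1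
  have hcol : ∀ k, ∑ j, ‖N j k‖ ^ 2 ≤ ((Wᴴ * σ * W) k k).re ^ t := fun k => by
    have h := sum_norm_sq_row_le hσ hW hV' htpos ht1 k
    have e : Wᴴ * suppPow σ (t / 2) * V = Nᴴ := by
      rw [hN, conjTranspose_mul, conjTranspose_mul, conjTranspose_conjTranspose, hS.eq, mul_assoc]
    simpa only [V, W, e, conjTranspose_apply, norm_star] using h
  have hle : ∀ k, |hZ.eigenvalues k| ≤ ∑ j, ‖N j k‖ ^ 2 * |hY.eigenvalues j| :=
    abs_eigenvalues_conj_le hS hY hZ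
  rw [alphaNorm_eq_sum hZ hαt]
  by_cases hβ : β = ∞
  · subst hβ
    -- Since `∞.toReal = 0` and `1 / 0 = 0`, here `t = 1 / α`.
    have hta : t * α.toReal = 1 := by rw [ht]; simp [hα0.ne']
    have hk : ∀ k, |hZ.eigenvalues k| ^ α.toReal ≤
        ((Wᴴ * σ * W) k k).re * alphaNorm ∞ Y ^ α.toReal := fun k => by
      have hv := conj_apply_re_nonneg hσ W k
      have hn : 0 ≤ alphaNorm ∞ Y := (abs_nonneg _).trans (abs_eigenvalues_le_alphaNorm_top hY k)
      have h : |hZ.eigenvalues k| ≤ ((Wᴴ * σ * W) k k).re ^ t * alphaNorm ∞ Y := by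
        refine (hle k).trans ((sum_le_sum fun j _ => mul_le_mul_of_nonneg_left
          (abs_eigenvalues_le_alphaNorm_top hY j) (by positivity)).trans ?_)
        rw [← sum_mul]
        exact mul_le_mul_of_nonneg_right (hcol k) hn
      refine (Real.rpow_le_rpow (abs_nonneg _) h hα0.le).trans_eq ?_
      rw [Real.mul_rpow (Real.rpow_nonneg hv _) hn, ← Real.rpow_mul hv, hta, Real.rpow_one]
    have hn : 0 ≤ alphaNorm ∞ Y := by
      rw [alphaNorm, if_pos rfl]; exact norm_nonneg _
    have h := sum_le_sum fun k (_ : k ∈ univ) => hk k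
    rw [← sum_mul, sum_conj_apply_re hσ1 hW', one_mul] at h
    refine (Real.rpow_le_rpow (by positivity) h (by positivity)).trans_eq ?_
    rw [← Real.rpow_mul hn, mul_one_div_cancel hα0.ne', Real.rpow_one]
  · have hβ0 : 0 < β.toReal := hα0.trans ((ENNReal.toReal_lt_toReal hαt hβ).2 hαβ)
    have hat : 1 / β.toReal + t = 1 / α.toReal := by rw [ht]; ring
    have h := sum_rpow_le_of_row_col_sums (fun j k => ‖N j k‖ ^ 2) (fun _ _ => by positivity)
      (fun j => |hY.eigenvalues j|) (fun _ => abs_nonneg _)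
      (fun j => ((Vᴴ * σ * V) j j).re) (conj_apply_re_nonneg hσ V) (sum_conj_apply_re hσ1 hV')
      (fun k => ((Wᴴ * σ * W) k k).re) (conj_apply_re_nonneg hσ W) (sum_conj_apply_re hσ1 hW')
      (a := 1 / β.toReal) (t := t) (by positivity) htpos.le (by rw [hat]; exact hinv1) hrow hcol
    rw [hat, one_div_one_div, one_div_one_div] at h
    rw [alphaNorm_eq_sum hY hβ]
    have h2 : ∑ k, |hZ.eigenvalues k| ^ α.toReal ≤
        (∑ j, |hY.eigenvalues j| ^ β.toReal) ^ (1 / β.toReal / (1 / α.toReal)) :=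
      (sum_le_sum fun k _ => Real.rpow_le_rpow (abs_nonneg _) (hle k) hα0.le).trans h
    refine (Real.rpow_le_rpow (by positivity) h2 (by positivity)).trans_eq ?_
    rw [← Real.rpow_mul (by positivity)]
    congr 1
    field_simp

/-! ### Monotonicity in the order and the endpoint `α = 1` -/

/-- At `α = ∞`, `1 / α.toReal` is `0`, so one formula covers both cases. -/
theorem expo_eq {α : ℝ≥0∞} (hα : 1 ≤ α) : expo α = (1 / α.toReal - 1) / 2 := by
  rw [expo]
  split_ifs with h
  · simp [h]
  · have : 0 < α.toReal := ENNReal.toReal_pos (by positivity) h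
    field_simp

theorem mu_mono {σ X : Matrix n n ℂ} (hσ : σ.PosSemidef) (hσ1 : σ.trace = 1)
    (hX : X.IsHermitian) {α β : ℝ≥0∞} (hα : 1 ≤ α) (hαβ : α ≤ β) : mu α X σ ≤ mu β X σ := by
  rcases hαβ.eq_or_lt with rfl | hlt
  · exact le_rfl
  rw [mu, mu]
  split_ifs with h
  · refine ENNReal.ofReal_le_ofReal ?_
    set t := 1 / α.toReal - 1 / β.toReal with ht
    have hB := isHermitian_suppPow σ (expo β)
    have hY : (suppPow σ (expo β) * X * suppPow σ (expo β)).IsHermitian := by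
      rw [IsHermitian, conjTranspose_mul, conjTranspose_mul, hB.eq, hX.eq, mul_assoc]
    have hsum : t / 2 + expo β = expo α := by
      rw [expo_eq hα, expo_eq (hα.trans hαβ), ht]; ring
    have hsum' : expo β + t / 2 = expo α := by rw [add_comm, hsum]
    refine le_of_eq_of_le ?_ (alphaNorm_conj_suppPow_le hσ hσ1 hY hα hlt ht)
    congr 1
    rw [← mul_assoc, ← mul_assoc, suppPow_mul_suppPow hσ, mul_assoc _ (suppPow σ (expo β)),
      suppPow_mul_suppPow hσ, hsum, hsum']
  · exact le_rfl

theorem mu_one {σ X : Matrix n n ℂ} (hσ : σ.IsHermitian) (hX : X.IsHermitian)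
    (h : supp X ≤ supp σ) : mu 1 X σ = ENNReal.ofReal (traceNorm X) := by
  have he : expo 1 = 0 := by simp [expo]
  rw [mu, if_pos h, he, suppPow_zero_mul_mul hσ hX h, alphaNorm_eq_sum hX ENNReal.one_ne_top,
    traceNorm_eq_sum hX]
  simp

theorem nu_mono {σ X : Matrix n n ℂ} (hσ : σ.PosSemidef) (hσ1 : σ.trace = 1)
    (hX : X.IsHermitian) {α β : ℝ≥0∞} (hα : 1 ≤ α) (hαβ : α ≤ β) : nu α X σ ≤ nu β X σ :=
  EReal.div_le_div_right_of_nonneg (by exact_mod_cast Real.log_nonneg one_le_two)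
    (ENNReal.log_monotone (mu_mono hσ hσ1 hX hα hαβ))

theorem logb_traceNorm_le_nu_one {σ X : Matrix n n ℂ} (hσ : σ.IsHermitian) (hX : X.IsHermitian)
    (hpos : 0 < traceNorm X) : ((Real.logb 2 (traceNorm X) : ℝ) : EReal) ≤ nu 1 X σ := by
  by_cases h : supp X ≤ supp σ
  · rw [nu, mu_one hσ hX h, ENNReal.log_ofReal_of_pos hpos, ← EReal.coe_div, Real.logb]
  · rw [nu, mu, if_neg h, ENNReal.log_top, EReal.top_div_of_pos_ne_top _ (EReal.coe_ne_top _)]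
    · exact le_top
    · exact_mod_cast Real.log_pos one_lt_two

/-- The trace is at most the sum of absolute eigenvalues. Positivity makes the real logarithm agree
with `ENNReal.log`. -/
theorem traceNorm_pos {X : Matrix n n ℂ} (hX : X.IsHermitian) (h1 : X.trace = 1) :
    0 < traceNorm X := by
  have h : ∑ i, hX.eigenvalues i = 1 := by
    have := trace_cfc hX (fun x => x)
    rw [cfc_real_id hX, h1] at this
    simpa using this.symm
  rw [traceNorm_eq_sum hX]
  exact zero_lt_one.trans_le (h.symm.le.trans (sum_le_sum fun i _ => le_abs_self _))

end Spectral

/-! ### Hermiticity and trace under partial transposition -/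

section PartialTranspose

variable {a b : Type*} [Fintype a] [DecidableEq a] [Fintype b] [DecidableEq b]

theorem isHermitian_partialTranspose {ρ : Matrix (a × b) (a × b) ℂ} (hρ : ρ.IsHermitian) :
    (partialTranspose ρ).IsHermitian := by
  ext p q
  rw [Matrix.conjTranspose_apply, partialTranspose_apply, partialTranspose_apply, hρ.apply]

theorem trace_partialTranspose (ρ : Matrix (a × b) (a × b) ℂ) :
    (partialTranspose ρ).trace = ρ.trace := by
  simp [Matrix.trace, partialTranspose_apply]

end PartialTranspose

end LogNeg

theorem mainTheorem2 {a b : Type*} [Fintype a] [DecidableEq a] [Fintype b] [DecidableEq b]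
    (ρ : Matrix (a × b) (a × b) ℂ) (hρ : LogNeg.IsState ρ)
    (α β : ℝ≥0∞) (hα : 1 ≤ α) (hαβ : α ≤ β) :
    (LogNeg.logNeg ρ : EReal) ≤ LogNeg.alphaLogNeg α ρ ∧
      LogNeg.alphaLogNeg α ρ ≤ LogNeg.alphaLogNeg β ρ := by
  have hX := LogNeg.isHermitian_partialTranspose hρ.1.1
  constructor
  · refine le_iInf₂ fun σ hσ => ?_
    exact (LogNeg.logb_traceNorm_le_nu_one hσ.1.1 hX
      (LogNeg.traceNorm_pos hX (by rw [LogNeg.trace_partialTranspose, hρ.2]))).trans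
      (LogNeg.nu_mono hσ.1 hσ.2.2 hX le_rfl hα)
  · exact iInf₂_mono fun σ hσ => LogNeg.nu_mono hσ.1 hσ.2.2 hX hα hαβ
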